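/- Let $P_0\neq P_1$ be mutually absolutely continuous probability measures on $\mathbb R$ that have probability densities, let $\pi_0\in[0,1]$ and $c>0$. Let $s=0,1,2,\dots$ index independent sequences $(Y^s_k)_{k\ge 1}$: each sequence, independently of the others, is with probability $\pi_0$ i.i.d. $\sim P_1$ (its label is $1$) and with probability $1-\pi_0$ i.i.d. $\sim P_0$ (its label is $0$). Scanning stage. The sequences are grouped into pairs $(2n,2n+1)$, $n=0,1,\dots$. At each time $k\ge1$ the observer sees $Z_k=Y^{2n_k}_k+Y^{2n_k+1}_k$, where $n_1=0$ and $n_{k+1}=n_k+\phi_k$. Here $\boldsymbol\phi=(\phi_1,\phi_2,\dots)$ is a switching rule: $\phi_k\in\{0,1\}$ is $\mathcal F_k$-measurable, with $\mathcal F_k=\sigma(Z_1,\dots,Z_k)$ and $\mathcal F_0$ trivial. The stage ends at an $(\mathcal F_k)_{k\ge0}$-stopping time $\tau_0$ with values in $\{0,1,\dots\}\cup\{\infty\}$. Its final pair is pair number $n_{\tau_0}$, with $n_0=0$. Refinement stage. One then observes $X_j=Y^{2n_{\tau_0}}_{\tau_0+j}$, $j\ge1$. Let $\mathcal G_j=\sigma(Z_1,\dots,Z_{\tau_0},X_1,\dots,X_j)=\mathcal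 F_{\tau_0}\vee\sigma(X_1,\dots,X_j)$, and let $\tau_1$ be a stopping time of $(\mathcal G_j)_{j\ge0}$ with values in $\{0,1,\dots\}\cup\{\infty\}$. For $a,b\in\{0,1\}$ let $r^{a,b}_j$ be the conditional probability given $\mathcal G_j$ that the sequences $2n_{\tau_0}$ and $2n_{\tau_0}+1$ have labels $a$ and $b$, respectively. Put $q_{1,j}=r^{1,1}_j+r^{1,0}_j$ and $q_{2,j}=r^{1,1}_j+r^{0,1}_j$. A cost is $+\infty$ wherever a stopping time in it is infinite. Define $$w_0=\inf_{\tau_0,\boldsymbol\phi,\tau_1}\mathbb E\big[c(\tau_0+\tau_1)+1-\max\{q_{1,\tau_1},q_{2,\tau_1}\}\big],$$ $$v(\tau_0,\boldsymbol\phi)=\operatorname*{ess\,inf}_{\tau_1}\mathbb E\big[c\tau_1+1-\max\{q_{1,\tau_1},q_{2,\tau_1}\}\,\big|\,\mathcal F_{\tau_0}\big],$$ $$u_0=\inf_{\tau_0,\boldsymbol\phi}\mathbb E\big[c\tau_0+v(\tau_0,\boldsymbol\phi)\big].$$ Then $w_0=u_0$. -/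

import Mathlib

open MeasureTheory ProbabilityTheory
open scoped ENNReal

noncomputable section

namespace QuickestSearch

/-! ### Essential infimum of a (possibly uncountable) family -/

/-- `v` is an essential infimum under `P` of the family `Φ` of `[0,∞]`-valued random variables:
a random variable that is almost surely below every member of the family, and almost surely
above every other such random variable. It is unique up to `P`-null sets. -/
structure IsEssInf {Ω : Type*} [MeasurableSpace Ω] {ι : Type*} (P : Measure Ω)
    (Φ : ι → Ω → ℝ≥0∞) (v : Ω → ℝ≥0∞) : Prop where
  measurable : Measurable v
  le : ∀ i, v ≤ᵐ[P] Φ i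
  greatest : ∀ u : Ω → ℝ≥0∞, Measurable u → (∀ i, u ≤ᵐ[P] Φ i) → u ≤ᵐ[P] v

theorem exists_isEssInf {Ω : Type*} [MeasurableSpace Ω] {ι : Type*} (P : Measure Ω)
    [IsFiniteMeasure P] (Φ : ι → Ω → ℝ≥0∞) (hΦ : ∀ i, Measurable (Φ i)) :
    ∃ v, IsEssInf P Φ v := by
  rcases isEmpty_or_nonempty ι with hι | hι
  · exact ⟨fun _ => ⊤, measurable_const, fun i => hι.elim i,
      fun u _ _ => Filter.Eventually.of_forall fun _ => le_top⟩
  let e : ℝ≥0∞ → ℝ≥0∞ := fun x => (x⁻¹ + 1)⁻¹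
  have he_meas : Measurable e := by fun_prop
  have he_mono : ∀ x y, e x ≤ e y ↔ x ≤ y := fun x y => by
    simp only [e]
    rw [ENNReal.inv_le_inv, ENNReal.add_le_add_iff_right ENNReal.one_ne_top,
      ENNReal.inv_le_inv]
  have he_le : ∀ x, e x ≤ 1 := fun x => by
    simp only [e]
    rw [ENNReal.inv_le_one]
    exact le_add_self
  let I : (ℕ → ι) → ℝ≥0∞ := fun a => ∫⁻ ω, e (⨅ n, Φ (a n) ω) ∂P
  obtain ⟨s, -, hs, hmem⟩ := exists_seq_tendsto_sInf (Set.range_nonempty I)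
    (OrderBot.bddBelow _)
  choose a ha using hmem
  let b : ℕ → ι := fun n => a n.unpair.1 n.unpair.2
  have hb : ∀ k ω, ⨅ n, Φ (b n) ω ≤ ⨅ n, Φ (a k n) ω := fun k ω =>
    le_iInf fun n => (iInf_le _ (Nat.pair k n)).trans (by simp [b])
  have hbI : I b ≤ sInf (Set.range I) := by
    refine ge_of_tendsto' hs fun k => ?_
    rw [← ha k]
    exact lintegral_mono fun ω => (he_mono _ _).2 (hb k ω)
  have hmeas : Measurable fun ω => ⨅ n, Φ (b n) ω := Measurable.iInf fun n => hΦ _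
  refine ⟨fun ω => ⨅ n, Φ (b n) ω, hmeas, fun i => ?_, fun u _ hui => ?_⟩
  · let d : ℕ → ι := fun n => Nat.casesOn n i b
    have hd1 : ∀ ω, ⨅ n, Φ (d n) ω ≤ Φ i ω := fun ω => iInf_le _ 0
    have hd2 : ∀ ω, ⨅ n, Φ (d n) ω ≤ ⨅ n, Φ (b n) ω := fun ω =>
      le_iInf fun n => iInf_le (fun n => Φ (d n) ω) (n + 1)
    have hle : (fun ω => e (⨅ n, Φ (d n) ω)) ≤ᵐ[P] fun ω => e (⨅ n, Φ (b n) ω) :=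
      Filter.Eventually.of_forall fun ω => (he_mono _ _).2 (hd2 ω)
    have hfin : ∫⁻ ω, e (⨅ n, Φ (d n) ω) ∂P ≠ ⊤ := by
      refine ((lintegral_mono fun ω => he_le _).trans_lt ?_).ne
      simp
    have hae := ae_eq_of_ae_le_of_lintegral_le hle hfin
      (he_meas.comp hmeas).aemeasurable (hbI.trans (sInf_le ⟨d, rfl⟩))
    filter_upwards [hae] with ω hω
    exact ((he_mono _ _).1 hω.ge).trans (hd1 ω)
  · filter_upwards [ae_all_iff.2 fun n => hui (b n)] with ω hω
    exact le_iInf hω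

/-- The essential infimum of a family of `[0,∞]`-valued random variables (some version of it). -/
def essInfFamily {Ω : Type*} [MeasurableSpace Ω] {ι : Type*} (P : Measure Ω)
    [IsFiniteMeasure P] (Φ : ι → Ω → ℝ≥0∞) (hΦ : ∀ i, Measurable (Φ i)) : Ω → ℝ≥0∞ :=
  (exists_isEssInf P Φ hΦ).choose

theorem isEssInf_essInfFamily {Ω : Type*} [MeasurableSpace Ω] {ι : Type*} (P : Measure Ω)
    [IsFiniteMeasure P] (Φ : ι → Ω → ℝ≥0∞) (hΦ : ∀ i, Measurable (Φ i)) :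
    IsEssInf P Φ (essInfFamily P Φ hΦ) :=
  (exists_isEssInf P Φ hΦ).choose_spec

/-! ### The sequences -/

/-- The joint law of the label of one sequence and its samples: with probability `π₀` the label is
`true` and the samples are i.i.d. `P₁`; with probability `1 - π₀` the label is `false` and the
samples are i.i.d. `P₀`. -/
def sequenceLaw (P₀ P₁ : Measure ℝ) (π₀ : ℝ) : Measure (Bool × (ℕ → ℝ)) :=
  ENNReal.ofReal π₀ • (Measure.dirac true).prod (Measure.infinitePi fun _ : ℕ => P₁) +
    ENNReal.ofReal (1 - π₀) • (Measure.dirac false).prod (Measure.infinitePi fun _ : ℕ => P₀)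

/-- Infinitely many independent sequences on a probability space `(Ω, P)`. `H s ω = true` means
that sequence `s` is generated by `P₁` (hypothesis `H₁`), and `Y s k` is the sample of sequence `s`
at time `k`. Times are `1, 2, …`; the value `Y s 0` is never observed. -/
structure Sequences {Ω : Type*} [MeasurableSpace Ω] (P : Measure Ω) (P₀ P₁ : Measure ℝ)
    (π₀ : ℝ) where
  H : ℕ → Ω → Bool
  Y : ℕ → ℕ → Ω → ℝ
  measurable_H : ∀ s, Measurable (H s)
  measurable_Y : ∀ s k, Measurable (Y s k)
  indep : iIndepFun (fun s ω => (H s ω, fun k => Y s k ω)) P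
  law : ∀ s, P.map (fun ω => (H s ω, fun k => Y s k ω)) = sequenceLaw P₀ P₁ π₀

variable {Ω : Type*} [mΩ : MeasurableSpace Ω] {P : Measure Ω} {P₀ P₁ : Measure ℝ} {π₀ : ℝ}

/-! ### Scanning stage -/

/-- Index of the pair of sequences observed at time `k` under the switching indicators `φ`. The
first pair has index `0`, it is also the current pair at time `0`, and the observer moves from the
pair observed at time `k ≥ 1` to the next, new pair iff `φ k = 1`. -/
def pairIndex (φ : ℕ → Ω → Bool) : ℕ → Ω → ℕ
  | 0, _ => 0
  | k + 1, ω => pairIndex φ k ω + if 1 ≤ k ∧ φ k ω = true then 1 else 0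

namespace Sequences

variable (M : Sequences P P₀ P₁ π₀)

/-- The mixed observation `Z k`, the sum of the time-`k` samples of the two sequences
`2 * n` and `2 * n + 1` of the current pair `n`. -/
def mixedObs (φ : ℕ → Ω → Bool) (k : ℕ) (ω : Ω) : ℝ :=
  M.Y (2 * pairIndex φ k ω) k ω + M.Y (2 * pairIndex φ k ω + 1) k ω

/-- `F k = σ(Z 1, …, Z k)`. -/
abbrev scanSigma (φ : ℕ → Ω → Bool) (k : ℕ) : MeasurableSpace Ω :=
  ⨆ i ∈ Set.Icc 1 k, MeasurableSpace.comap (M.mixedObs φ i) inferInstance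

/-- Sequences of switching decisions, `φ k` being a `{0,1}`-valued function of `Z 1, …, Z k`. -/
structure SwitchingRule where
  φ : ℕ → Ω → Bool
  adapted : ∀ k, 1 ≤ k → Measurable[M.scanSigma φ k] (φ k)

namespace SwitchingRule

variable {M} (R : M.SwitchingRule)

theorem measurable_mixedObs_of_pairIndex {k : ℕ} (h : Measurable (pairIndex R.φ k)) :
    Measurable (M.mixedObs R.φ k) := by
  have key : ∀ f : ℕ → ℕ, Measurable fun ω => M.Y (f (pairIndex R.φ k ω)) k ω := fun f => by
    have : Measurable fun p : Ω × ℕ => M.Y (f p.2) k p.1 :=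
      measurable_from_prod_countable_left fun n => M.measurable_Y (f n) k
    exact this.comp (measurable_id.prodMk h)
  exact (key fun n => 2 * n).add (key fun n => 2 * n + 1)

theorem measurable_pairIndex (k : ℕ) : Measurable (pairIndex R.φ k) := by
  induction k using Nat.strong_induction_on with
  | _ k ih =>
    cases k with
    | zero => exact measurable_const
    | succ k =>
      have hF : M.scanSigma R.φ k ≤ mΩ := iSup₂_le fun i hi =>
        (R.measurable_mixedObs_of_pairIndex (ih i (Nat.lt_succ_of_le hi.2))).comap_le
      refine (ih k (Nat.lt_succ_self k)).add (Measurable.ite ?_ measurable_const measurable_const)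
      by_cases hk : 1 ≤ k
      · simp only [hk, true_and]
        exact ((R.adapted k hk).mono hF le_rfl) (measurableSet_singleton true)
      · simp [hk]

theorem measurable_mixedObs (k : ℕ) : Measurable (M.mixedObs R.φ k) :=
  R.measurable_mixedObs_of_pairIndex (R.measurable_pairIndex k)

/-- The filtration `F k = σ(Z 1, …, Z k)` of the scanning stage. -/
def scanFiltration : Filtration ℕ mΩ where
  seq := M.scanSigma R.φ
  mono' _ _ h := biSup_mono fun _ hi => ⟨hi.1, hi.2.trans h⟩
  le' _ := iSup₂_le fun i _ => (R.measurable_mixedObs i).comap_le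

end SwitchingRule

/-- The decisions of the scanning stage: a switching rule `φ` and a stopping time `τ₀` of the
filtration of the scanning stage (possibly `0` and possibly infinite). -/
structure ScanPolicy where
  rule : M.SwitchingRule
  τ₀ : Ω → ℕ∞
  isStoppingTime : IsStoppingTime rule.scanFiltration τ₀

namespace ScanPolicy

variable {M} (S : M.ScanPolicy)

/-- The stopped σ-algebra `F_{τ₀}`. -/
abbrev stoppedSigma : MeasurableSpace Ω := S.isStoppingTime.measurableSpace

theorem stoppedSigma_le : S.stoppedSigma ≤ mΩ := S.isStoppingTime.measurableSpace_le

/-- `τ₀` as a natural number. The value `0` where `τ₀ = ∞` is immaterial, because the cost is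
infinite there. -/
def endTime (ω : Ω) : ℕ := (S.τ₀ ω).toNat

/-- Index of the pair of sequences that enters the refinement stage. -/
def finalPair (ω : Ω) : ℕ := pairIndex S.rule.φ (S.endTime ω) ω

/-! ### Refinement stage -/

/-- `X j`, the sample at time `τ₀ + j` of the first sequence of the final pair. -/
def refineObs (j : ℕ) (ω : Ω) : ℝ := M.Y (2 * S.finalPair ω) (S.endTime ω + j) ω

theorem measurable_endTime : Measurable S.endTime :=
  (measurable_of_countable (α := WithTop ℕ) fun x => ENat.toNat x).comp S.isStoppingTime.measurable'

theorem measurable_finalPair : Measurable S.finalPair := by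
  have : Measurable fun p : Ω × ℕ => pairIndex S.rule.φ p.2 p.1 :=
    measurable_from_prod_countable_left fun n =>
      S.rule.measurable_pairIndex n
  exact this.comp (measurable_id.prodMk S.measurable_endTime)

theorem measurable_refineObs (j : ℕ) : Measurable (S.refineObs j) := by
  have : Measurable fun p : Ω × (ℕ × ℕ) => M.Y (2 * p.2.1) (p.2.2 + j) p.1 :=
    measurable_from_prod_countable_left fun n => M.measurable_Y (2 * n.1) (n.2 + j)
  exact this.comp (measurable_id.prodMk (S.measurable_finalPair.prodMk S.measurable_endTime))

/-- The filtration `G j = σ(Z 1, …, Z τ₀, X 1, …, X j)` of the refinement stage. -/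
def refineFiltration : Filtration ℕ mΩ where
  seq j := S.stoppedSigma ⊔
    ⨆ i ∈ Set.Icc 1 j, MeasurableSpace.comap (S.refineObs i) inferInstance
  mono' _ _ h := sup_le_sup_left (biSup_mono fun _ hi => ⟨hi.1, hi.2.trans h⟩) _
  le' _ := sup_le S.stoppedSigma_le (iSup₂_le fun i _ => (S.measurable_refineObs i).comap_le)

/-- The stopping times `τ₁` of the refinement stage. -/
def RefineTime : Type _ := {τ₁ : Ω → ℕ∞ // IsStoppingTime S.refineFiltration τ₁}

/-- The posterior probability, given `G j`, that the two sequences of the final pair have the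
labels `a` and `b`. -/
def r (a b : Bool) (j : ℕ) : Ω → ℝ :=
  P⟦{ω | M.H (2 * S.finalPair ω) ω = a ∧ M.H (2 * S.finalPair ω + 1) ω = b} |
    S.refineFiltration j⟧

/-- `q_{1,j} = r^{1,1}_j + r^{1,0}_j`. -/
def q₁ (j : ℕ) (ω : Ω) : ℝ := S.r true true j ω + S.r true false j ω

/-- `q_{2,j} = r^{1,1}_j + r^{0,1}_j`. -/
def q₂ (j : ℕ) (ω : Ω) : ℝ := S.r true true j ω + S.r false true j ω

/-- The false identification cost `1 - max {q_{1,τ₁}, q_{2,τ₁}}`, which is almost surely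
nonnegative. Its value where `τ₁ = ∞` is immaterial, because the cost is infinite there. -/
def errorCost (τ₁ : S.RefineTime) (ω : Ω) : ℝ≥0∞ :=
  ENNReal.ofReal (1 - max (S.q₁ (τ₁.1 ω).toNat ω) (S.q₂ (τ₁.1 ω).toNat ω))

/-- `v(τ₀, φ) = ess inf_{τ₁} E[c τ₁ + 1 - max {q_{1,τ₁}, q_{2,τ₁}} | F_{τ₀}]`. -/
def refineValue [IsFiniteMeasure P] (c : ℝ) : Ω → ℝ≥0∞ :=
  essInfFamily P
    (fun τ₁ : S.RefineTime =>
      P⁻[fun ω => ENNReal.ofReal c * (τ₁.1 ω : ℝ≥0∞) + S.errorCost τ₁ ω | S.stoppedSigma])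
    (fun _ => measurable_condLExp' _ _ _)

end ScanPolicy

/-! ### The two optimisation problems -/

/-- `w₀ = inf_{τ₀, φ, τ₁} E[c (τ₀ + τ₁) + 1 - max {q_{1,τ₁}, q_{2,τ₁}}]`. -/
def jointValue (c : ℝ) : ℝ≥0∞ :=
  ⨅ (S : M.ScanPolicy) (τ₁ : S.RefineTime),
    ∫⁻ ω, (ENNReal.ofReal c * ((S.τ₀ ω : ℝ≥0∞) + (τ₁.1 ω : ℝ≥0∞)) + S.errorCost τ₁ ω) ∂P

/-- `u₀ = inf_{τ₀, φ} E[c τ₀ + v(τ₀, φ)]`. -/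
def concatenatedValue [IsFiniteMeasure P] (c : ℝ) : ℝ≥0∞ :=
  ⨅ S : M.ScanPolicy, ∫⁻ ω, (ENNReal.ofReal c * (S.τ₀ ω : ℝ≥0∞) + S.refineValue c ω) ∂P

end Sequences

end QuickestSearch

end

/-! The stopping times of the refinement stage can be pasted along any event of `F_{τ₀}`, because
`F_{τ₀} = G 0`. Pasting two of them along the event where the conditional expected cost of the
first is the smaller one realises the pointwise minimum of the two conditional costs. Hence the
conditional costs given `F_{τ₀}` are directed downwards, so by monotone convergence along a
minimising sequence the expectation of their essential infimum is the infimum of their expectations.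
By the tower property this infimum is the optimal expected cost of the refinement stage after the
given scanning stage, and it remains to add `c τ₀` and minimise over the scanning stage. -/

namespace QuickestSearch

section EssInf

variable {Ω ι : Type*} [MeasurableSpace Ω] {P : Measure Ω} {Φ : ι → Ω → ℝ≥0∞}

theorem exists_seq_ae_antitone_lintegral_iInf_le
    (hdir : Directed (fun f g => g ≤ᵐ[P] f) Φ) (i₀ : ι) :
    ∃ b : ℕ → ι, b 0 = i₀ ∧ (∀ n, Φ (b (n + 1)) ≤ᵐ[P] Φ (b n)) ∧
      ∫⁻ ω, ⨅ n, Φ (b n) ω ∂P ≤ ⨅ i, ∫⁻ ω, Φ i ω ∂P := by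
  have : Nonempty ι := ⟨i₀⟩
  obtain ⟨s, -, hs_tendsto, hs_mem⟩ := exists_seq_tendsto_sInf
    (Set.range_nonempty fun i => ∫⁻ ω, Φ i ω ∂P) (OrderBot.bddBelow _)
  choose a ha using hs_mem
  choose meet meet_le_left meet_le_right using hdir
  let b : ℕ → ι := fun n => Nat.rec i₀ (fun k i => meet i (a k)) n
  refine ⟨b, rfl, fun n => meet_le_left _ _, ge_of_tendsto' hs_tendsto fun n => ?_⟩
  calc ∫⁻ ω, ⨅ k, Φ (b k) ω ∂P
      ≤ ∫⁻ ω, Φ (b (n + 1)) ω ∂P := lintegral_mono fun ω => iInf_le _ (n + 1)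
    _ ≤ ∫⁻ ω, Φ (a n) ω ∂P := lintegral_mono_ae (meet_le_right _ _)
    _ = s n := ha n

theorem iInf_ae_le_of_lintegral_iInf_le (hΦ : ∀ i, Measurable (Φ i))
    (hdir : Directed (fun f g => g ≤ᵐ[P] f) Φ) {b : ℕ → ι}
    (hb_anti : ∀ n, Φ (b (n + 1)) ≤ᵐ[P] Φ (b n)) (hb_fin : ∫⁻ ω, Φ (b 0) ω ∂P ≠ ∞)
    (hb_min : ∫⁻ ω, ⨅ n, Φ (b n) ω ∂P ≤ ⨅ i, ∫⁻ ω, Φ i ω ∂P) (i : ι) :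
    (fun ω => ⨅ n, Φ (b n) ω) ≤ᵐ[P] Φ i := by
  let u : Ω → ℝ≥0∞ := fun ω => ⨅ n, Φ (b n) ω
  have lintegral_meet (j : ι) : ⨅ k, ∫⁻ ω, Φ k ω ∂P ≤ ∫⁻ ω, Φ j ω ⊓ Φ i ω ∂P := by
    obtain ⟨k, hkj, hki⟩ := hdir j i
    exact (iInf_le _ k).trans (lintegral_mono_ae (hkj.le_inf hki))
  have lintegral_u_le : ∫⁻ ω, u ω ∂P ≤ ∫⁻ ω, u ω ⊓ Φ i ω ∂P := calc
    ∫⁻ ω, u ω ∂P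
      ≤ ⨅ n, ∫⁻ ω, Φ (b n) ω ⊓ Φ i ω ∂P := hb_min.trans (le_iInf fun n => lintegral_meet (b n))
    _ = ∫⁻ ω, ⨅ n, Φ (b n) ω ⊓ Φ i ω ∂P := by
      refine (lintegral_iInf_ae (fun n => (hΦ _).inf (hΦ i)) (fun n => ?_) ?_).symm
      · exact (hb_anti n).mono fun ω h => inf_le_inf_right _ h
      · exact ne_top_of_le_ne_top hb_fin (lintegral_mono fun ω => inf_le_left)
    _ = ∫⁻ ω, u ω ⊓ Φ i ω ∂P := by simp only [u, iInf_inf]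
  have u_fin : ∫⁻ ω, u ω ⊓ Φ i ω ∂P ≠ ∞ :=
    ne_top_of_le_ne_top hb_fin (lintegral_mono fun ω => inf_le_left.trans (iInf_le _ 0))
  have u_inf_eq : (fun ω => u ω ⊓ Φ i ω) =ᵐ[P] u :=
    ae_eq_of_ae_le_of_lintegral_le (ae_of_all _ fun _ => inf_le_left) u_fin
      (Measurable.iInf fun n => hΦ (b n)).aemeasurable lintegral_u_le
  exact u_inf_eq.mono fun ω h => inf_eq_left.1 h

theorem IsEssInf.lintegral_eq_iInf_of_directed {v : Ω → ℝ≥0∞} (hv : IsEssInf P Φ v)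
    (hΦ : ∀ i, Measurable (Φ i)) (hdir : Directed (fun f g => g ≤ᵐ[P] f) Φ)
    (hfin : ∃ i, ∫⁻ ω, Φ i ω ∂P ≠ ∞) :
    ∫⁻ ω, v ω ∂P = ⨅ i, ∫⁻ ω, Φ i ω ∂P := by
  obtain ⟨i₀, hi₀⟩ := hfin
  obtain ⟨b, rfl, hb_anti, hb_min⟩ := exists_seq_ae_antitone_lintegral_iInf_le hdir i₀
  have iInf_le_v : (fun ω => ⨅ n, Φ (b n) ω) ≤ᵐ[P] v :=
    hv.greatest _ (Measurable.iInf fun n => hΦ _)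
      (iInf_ae_le_of_lintegral_iInf_le hΦ hdir hb_anti hi₀ hb_min)
  apply le_antisymm
  · exact le_iInf fun i => lintegral_mono_ae (hv.le i)
  · calc ⨅ i, ∫⁻ ω, Φ i ω ∂P
        ≤ ⨅ n, ∫⁻ ω, Φ (b n) ω ∂P := le_iInf fun n => iInf_le _ (b n)
      _ = ∫⁻ ω, ⨅ n, Φ (b n) ω ∂P := (lintegral_iInf_ae (fun n => hΦ _) hb_anti hi₀).symm
      _ ≤ ∫⁻ ω, v ω ∂P := lintegral_mono_ae iInf_le_v

end EssInf

section Pasting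

variable {Ω ι : Type*} {m mΩ : MeasurableSpace Ω} {P : Measure[mΩ] Ω}

theorem condLExp_piecewise (hm : m ≤ mΩ) [SigmaFinite (P.trim hm)] (X Y : Ω → ℝ≥0∞) {A : Set Ω}
    [DecidablePred (· ∈ A)] (hA : MeasurableSet[m] A) :
    P⁻[A.piecewise X Y | m] =ᵐ[P] A.piecewise P⁻[X | m] P⁻[Y | m] := by
  refine (ae_eq_condLExp hm P _
    ((measurable_condLExp m P X).piecewise hA (measurable_condLExp m P Y)) fun s hs => ?_).symm
  simp only [lintegral_piecewise (hm _ hA), Measure.restrict_restrict (hm _ hA),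
    Measure.restrict_restrict (hm _ hA.compl), setLIntegral_condLExp hm P _ (hA.inter hs),
    setLIntegral_condLExp hm P _ (hA.compl.inter hs)]

/-- A family of random variables is stable under pasting along a σ-algebra `m` if, for any two
members and any event of `m`, the variable equal to the first on the event and to the second off it
is again a member, up to a null set. This is what makes conditional minimisation given `m` agree
with unconditional minimisation. -/
def IsPastingStable {β : Type*} (m : MeasurableSpace Ω) {mΩ : MeasurableSpace Ω} (P : Measure[mΩ] Ω)
    (X : ι → Ω → β) : Prop :=
  ∀ i j, ∀ ⦃A : Set Ω⦄ [DecidablePred (· ∈ A)], MeasurableSet[m] A →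
    ∃ k, X k =ᵐ[P] A.piecewise (X i) (X j)

variable {X : ι → Ω → ℝ≥0∞}

theorem IsPastingStable.directed_condLExp (hX : IsPastingStable m P X) (hm : m ≤ mΩ)
    [SigmaFinite (P.trim hm)] :
    Directed (fun f g => g ≤ᵐ[P] f) fun i => P⁻[X i | m] := by
  intro i j
  let A : Set Ω := {ω | P⁻[X i | m] ω ≤ P⁻[X j | m] ω}
  have hA : MeasurableSet[m] A :=
    @measurableSet_le _ _ _ _ _ m _ _ _ _ _ (measurable_condLExp _ _ _) (measurable_condLExp _ _ _)
  obtain ⟨k, hk⟩ := hX i j hA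
  have condLExp_eq_inf : P⁻[X k | m] =ᵐ[P] P⁻[X i | m] ⊓ P⁻[X j | m] := by
    filter_upwards [(condLExp_congr_ae hk).trans (condLExp_piecewise hm _ _ hA)] with ω hω
    simp [hω, A, Set.piecewise, min_def]
  exact ⟨k, condLExp_eq_inf.le.trans (ae_of_all _ fun _ => inf_le_left),
    condLExp_eq_inf.le.trans (ae_of_all _ fun _ => inf_le_right)⟩

theorem IsEssInf.lintegral_eq_iInf_of_isPastingStable {v : Ω → ℝ≥0∞}
    (hv : IsEssInf P (fun i => P⁻[X i | m]) v) (hX : IsPastingStable m P X) (hm : m ≤ mΩ)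
    [SigmaFinite (P.trim hm)] (hfin : ∃ i, ∫⁻ ω, X i ω ∂P ≠ ∞) :
    ∫⁻ ω, v ω ∂P = ⨅ i, ∫⁻ ω, X i ω ∂P := by
  simp only [← lintegral_condLExp hm P (X _)] at hfin ⊢
  exact hv.lintegral_eq_iInf_of_directed (fun _ => measurable_condLExp' _ _ _)
    (hX.directed_condLExp hm) hfin

end Pasting

namespace Sequences.ScanPolicy

variable {Ω : Type*} [MeasurableSpace Ω] {P : Measure Ω} {P₀ P₁ : Measure ℝ} {π₀ : ℝ}
  {M : Sequences P P₀ P₁ π₀} (S : M.ScanPolicy)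

/-- The cost `c τ₁ + 1 - max {q_{1,τ₁}, q_{2,τ₁}}` of the refinement stage. -/
noncomputable def refineCost (c : ℝ) (τ₁ : S.RefineTime) (ω : Ω) : ℝ≥0∞ :=
  ENNReal.ofReal c * (τ₁.1 ω : ℝ≥0∞) + S.errorCost τ₁ ω

/-- The stopping time that ends the refinement stage at once. -/
def zeroTime : S.RefineTime := ⟨fun _ => 0, isStoppingTime_const _ 0⟩

instance : Nonempty S.RefineTime := ⟨S.zeroTime⟩

/-- The stopping time that follows `σ` on an event `A` of `F_{τ₀}`, and `τ` off it. -/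
def pasteTime {A : Set Ω} [DecidablePred (· ∈ A)] (hA : MeasurableSet[S.stoppedSigma] A)
    (σ τ : S.RefineTime) : S.RefineTime :=
  ⟨A.piecewise σ.1 τ.1, σ.2.piecewise_of_le (i := 0) τ.2 (fun _ => zero_le) (fun _ => zero_le)
    ((le_sup_left : S.stoppedSigma ≤ S.refineFiltration 0) _ hA)⟩

theorem refineCost_pasteTime (c : ℝ) {A : Set Ω} [DecidablePred (· ∈ A)]
    (hA : MeasurableSet[S.stoppedSigma] A) (σ τ : S.RefineTime) :
    S.refineCost c (S.pasteTime hA σ τ) = A.piecewise (S.refineCost c σ) (S.refineCost c τ) := by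
  ext ω
  by_cases hω : ω ∈ A <;> simp [refineCost, errorCost, pasteTime, hω]

theorem isPastingStable_refineCost (c : ℝ) :
    IsPastingStable S.stoppedSigma P (S.refineCost c) :=
  fun σ τ _ _ hA => ⟨S.pasteTime hA σ τ, .of_eq (S.refineCost_pasteTime c hA σ τ)⟩

theorem measurable_ofReal_mul_τ₀ (c : ℝ) :
    Measurable fun ω => ENNReal.ofReal c * (S.τ₀ ω : ℝ≥0∞) :=
  ((measurable_of_countable (α := WithTop ℕ) fun n => ENat.toENNReal n).comp
    S.isStoppingTime.measurable').const_mul _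

theorem lintegral_jointCost_eq_add (c : ℝ) (τ₁ : S.RefineTime) :
    ∫⁻ ω, (ENNReal.ofReal c * ((S.τ₀ ω : ℝ≥0∞) + (τ₁.1 ω : ℝ≥0∞)) + S.errorCost τ₁ ω) ∂P =
      ∫⁻ ω, ENNReal.ofReal c * (S.τ₀ ω : ℝ≥0∞) ∂P + ∫⁻ ω, S.refineCost c τ₁ ω ∂P := by
  simp only [← lintegral_add_left (S.measurable_ofReal_mul_τ₀ c), refineCost, mul_add, add_assoc]

variable [IsFiniteMeasure P]

theorem lintegral_refineCost_zeroTime_ne_top (c : ℝ) :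
    ∫⁻ ω, S.refineCost c S.zeroTime ω ∂P ≠ ∞ := by
  have integrable_one_sub_q₁ : Integrable (fun ω => 1 - S.q₁ 0 ω) P :=
    (integrable_const 1).sub (integrable_condExp.add integrable_condExp)
  have refineCost_le (ω : Ω) : S.refineCost c S.zeroTime ω ≤ ENNReal.ofReal (1 - S.q₁ 0 ω) := by
    simp only [refineCost, errorCost, zeroTime, ENat.toENNReal_zero, mul_zero, zero_add,
      ENat.toNat_zero]
    gcongr
    exact le_max_left _ _
  exact ((lintegral_mono refineCost_le).trans_lt integrable_one_sub_q₁.lintegral_lt_top).ne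

theorem lintegral_refineValue (c : ℝ) :
    ∫⁻ ω, S.refineValue c ω ∂P = ⨅ τ₁ : S.RefineTime, ∫⁻ ω, S.refineCost c τ₁ ω ∂P :=
  (isEssInf_essInfFamily P (fun τ₁ => P⁻[S.refineCost c τ₁ | S.stoppedSigma])
    fun _ => measurable_condLExp' _ _ _).lintegral_eq_iInf_of_isPastingStable
    (S.isPastingStable_refineCost c) S.stoppedSigma_le
    ⟨S.zeroTime, S.lintegral_refineCost_zeroTime_ne_top c⟩

end Sequences.ScanPolicy

end QuickestSearch

theorem mainTheorem2_general {Ω : Type*} [MeasurableSpace Ω] {P : Measure Ω}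
    [IsProbabilityMeasure P] {P₀ P₁ : Measure ℝ} [IsProbabilityMeasure P₀]
    [IsProbabilityMeasure P₁] {π₀ c : ℝ} (_hc : 0 < c) (M : QuickestSearch.Sequences P P₀ P₁ π₀) :
    M.jointValue c = M.concatenatedValue c := by
  refine iInf_congr fun S => ?_
  calc ⨅ τ₁ : S.RefineTime, ∫⁻ ω, (ENNReal.ofReal c * ((S.τ₀ ω : ℝ≥0∞) + (τ₁.1 ω : ℝ≥0∞)) +
          S.errorCost τ₁ ω) ∂P
      = ⨅ τ₁ : S.RefineTime, (∫⁻ ω, ENNReal.ofReal c * (S.τ₀ ω : ℝ≥0∞) ∂P +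
          ∫⁻ ω, S.refineCost c τ₁ ω ∂P) := iInf_congr (S.lintegral_jointCost_eq_add c)
    _ = ∫⁻ ω, ENNReal.ofReal c * (S.τ₀ ω : ℝ≥0∞) ∂P +
          ⨅ τ₁ : S.RefineTime, ∫⁻ ω, S.refineCost c τ₁ ω ∂P := ENNReal.add_iInf.symm
    _ = ∫⁻ ω, ENNReal.ofReal c * (S.τ₀ ω : ℝ≥0∞) ∂P + ∫⁻ ω, S.refineValue c ω ∂P := by
      rw [S.lintegral_refineValue c]
    _ = ∫⁻ ω, (ENNReal.ofReal c * (S.τ₀ ω : ℝ≥0∞) + S.refineValue c ω) ∂P :=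
      (lintegral_add_left (S.measurable_ofReal_mul_τ₀ c) _).symm

theorem mainTheorem2 {Ω : Type*} [MeasurableSpace Ω] (P : Measure Ω) [IsProbabilityMeasure P]
    (P₀ P₁ : Measure ℝ) [IsProbabilityMeasure P₀] [IsProbabilityMeasure P₁]
    (hP₀_density : P₀ ≪ volume) (hP₁_density : P₁ ≪ volume)
    (hP₀P₁ : P₀ ≪ P₁) (hP₁P₀ : P₁ ≪ P₀) (hne : P₀ ≠ P₁)
    (π₀ : ℝ) (hπ₀ : π₀ ∈ Set.Icc (0 : ℝ) 1) (c : ℝ) (hc : 0 < c)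
    (M : QuickestSearch.Sequences P P₀ P₁ π₀) :
    M.jointValue c = M.concatenatedValue c :=
  mainTheorem2_general hc M
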